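/- For $r\ge 1$, let $A=\{a_1,\dots,a_r\}$, let $A_\star=\{a_1^\star,\dots,a_r^\star\}$ be a disjoint copy of $A$, and extend $a\mapsto a^\star$ to the involution of the free monoid $(A\cup A_\star)^*$ with $(a^\star)^\star=a$ and $(uv)^\star=v^\star u^\star$. The free regular $\star$-monoid of rank $r$ is the monoid \[ \mathbf F_r^\star=\mathrm{Mon}\langle A\cup A_\star \mid ww^\star w=w\ \text{ for all } w\in (A\cup A_\star)^*\rangle . \] A monoid $M$ is of type (left) $\mathrm{FP}_n$ if the trivial left $\mathbb ZM$-module $\mathbb Z$ has a projective resolution $\cdots\to P_1\to P_0\to\mathbb Z\to 0$ by left $\mathbb ZM$-modules with $P_i$ finitely generated for $1\le i\le n$; and $H_n(M,\mathbb Z)=\mathrm{Tor}_n^{\mathbb ZM}(\mathbb Z,\mathbb Z)$, where $\mathbb Z$ is the trivial module. **Corollary.** For every $r\ge 1$, the monoid $\mathbf F_r^\star$ is not of type $\mathrm{FP}_2$, and the abelian group $H_2(\mathbf F_r^\star,\mathbb Z)$ is not finitely generated. Moreover, for $r=1$, $H_2(\mathbf F_1^\star,\mathbb Z)\cong\mathbb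 Z^{\infty}$, the free abelian group of countably infinite rank. -/

import Mathlib

open CategoryTheory

/-- The formal involution on words over the alphabet `X ⊔ X_⋆`, which is modelled as `X ⊕ X`
(`Sum.inl x` is the letter `x` and `Sum.inr x` is the letter `x^⋆`): reverse the word and
exchange every letter with its starred partner, so that `(u v)^⋆ = v^⋆ u^⋆`. -/
def starWord {X : Type} (w : FreeMonoid (X ⊕ X)) : FreeMonoid (X ⊕ X) :=
  FreeMonoid.ofList ((w.toList.map Sum.swap).reverse)

/-- The defining relations `w w^⋆ w = w`, for all words `w` over `X ⊔ X_⋆`. -/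
def FreeRegularStarRel (X : Type) (u v : FreeMonoid (X ⊕ X)) : Prop :=
  ∃ w : FreeMonoid (X ⊕ X), u = w * starWord w * w ∧ v = w

/-- The free regular `⋆`-monoid on the set `X`: the monoid with presentation
`Mon⟨X ⊔ X_⋆ | w w^⋆ w = w for all words w⟩`. -/
abbrev FreeRegularStarMonoid (X : Type) : Type :=
  PresentedMonoid (FreeRegularStarRel X)

noncomputable section

namespace MonoidHomology

/-- The augmentation `ℤM → ℤ`, sending every element of `M` to `1`. -/
def augmentation (M : Type) [Monoid M] : MonoidAlgebra ℤ M →+* ℤ :=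
  (MonoidAlgebra.lift ℤ ℤ M (1 : M →* ℤ)).toRingHom

/-- `ℤ` as a trivial left `ℤM`-module: every element of `M` acts as the identity. -/
abbrev trivialModule (M : Type) [Monoid M] : ModuleCat.{0} (MonoidAlgebra ℤ M) :=
  (ModuleCat.restrictScalars (augmentation M)).obj (ModuleCat.of ℤ ℤ)

/-- `M` is of type (left) `FP_n`: the trivial left `ℤM`-module `ℤ` has a projective resolution
`⋯ → P₁ → P₀ → ℤ → 0` in which `P_i` is finitely generated for `1 ≤ i ≤ n`. (For `n ≥ 1` the
module `P₀` is then finitely generated as well, being an extension of `ℤ` by an image of `P₁`.) -/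
def IsFP (n : ℕ) (M : Type) [Monoid M] : Prop :=
  ∃ P : ProjectiveResolution (trivialModule M),
    ∀ i : ℕ, 1 ≤ i → i ≤ n → Module.Finite (MonoidAlgebra ℤ M) (P.complex.X i)

/-- The subgroup of a left `ℤM`-module `V` generated by all `m • v - v`. -/
def coinvariantsKer (M : Type) [Monoid M] (V : ModuleCat.{0} (MonoidAlgebra ℤ M)) :
    Submodule ℤ V :=
  Submodule.span ℤ {y : V | ∃ (m : M) (v : V), y = MonoidAlgebra.of ℤ M m • v - v}

theorem coinvariantsKer_le_comap (M : Type) [Monoid M]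
    {V W : ModuleCat.{0} (MonoidAlgebra ℤ M)} (f : V ⟶ W) :
    coinvariantsKer M V ≤ (coinvariantsKer M W).comap f.hom.toAddMonoidHom.toIntLinearMap := by
  refine Submodule.span_le.2 ?_
  rintro _ ⟨m, v, rfl⟩
  exact Submodule.subset_span ⟨m, f.hom v, by simp⟩

/-- The functor `ℤ ⊗_{ℤM} -` from left `ℤM`-modules to abelian groups, where `ℤ` is the trivial
right `ℤM`-module. It is realised as `V ↦ V / ⟨m • v - v⟩`. -/
def trivialTensor (M : Type) [Monoid M] :
    ModuleCat.{0} (MonoidAlgebra ℤ M) ⥤ ModuleCat.{0} ℤ where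
  obj V := ModuleCat.of ℤ (V ⧸ coinvariantsKer M V)
  map f := ModuleCat.ofHom ((coinvariantsKer M _).mapQ (coinvariantsKer M _)
    f.hom.toAddMonoidHom.toIntLinearMap (coinvariantsKer_le_comap M f))
  map_id V := by
    ext x
    rfl
  map_comp f g := by
    ext x
    rfl

instance trivialTensor_additive (M : Type) [Monoid M] : (trivialTensor M).Additive where
  map_add {V W f g} := by
    ext x
    obtain ⟨v, rfl⟩ := Submodule.Quotient.mk_surjective _ x
    rfl

/-- The integral homology `H_n(M, ℤ) = Tor_n^{ℤM}(ℤ, ℤ)` of the monoid `M`. -/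
def integralHomology (n : ℕ) (M : Type) [Monoid M] : ModuleCat.{0} ℤ :=
  ((trivialTensor M).leftDerived n).obj (trivialModule M)

end MonoidHomology

end

/-!
The second homology of the free regular `⋆`-monoid `M` on a set `X` is computed exactly: it is free
abelian on the set of pairs `{w, w^⋆}`, where `w` runs over the *tight* words of length at least
two. A word is tight if it is nonempty, contains no factor `v v^⋆ v`, and neither begins nor ends
with a word `s s^⋆` (`v`, `s` nonempty). Every power `x^n` of a generator is tight, so the rank is
infinite; and if `M` were of type `FP₂`, its second homology would be finitely generated.

*Homological part.* Let `K` be the kernel of the differential `d` of the complex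
`ℤM^(X ⊔ X_⋆) → ℤM → ℤ`, that is, the group of 1-cycles of the right Cayley graph of `M`. Then
`H₂(M, ℤ)` is the kernel of `ℤ ⊗ K → ℤ ⊗ ℤM^(X ⊔ X_⋆)`
(`nonempty_integralHomology_two_equiv_of_fox`). By Fox calculus, `K` is spanned by the differences
`∂u - ∂v` for words `u`, `v` equal in `M`, and an additive map on `ℤ ⊗ K` amounts to a function
`P u - P v` of such pairs that does not change when `u` and `v` are multiplied by the same word, on
either side (`mem_span_fox_sub`, `exists_chain_map`).

*Generators of `ℤ ⊗ K`.* If a congruence contains `w w^⋆ w = w` for all tight `w`, it contains all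
these relations, by induction on the length of `w` (`hom_relation_of_tight`). Hence the classes of
the tight relations generate `ℤ ⊗ K`; those of `w` and `w^⋆` agree, because `w w^⋆ w w^⋆` can be
shortened in two ways (`relCycle_bar_sub_mem`).

*Independence.* Let `f` be a function on words, with `f w^⋆ = f w`. Letters act from the left on
irreducible words: if multiplication by a letter creates a left side `v v^⋆ v`, it is a prefix, and
is replaced by `v` at the cost `f v`. The key point is `Tight.act_mul_bar`: for tight `w`, applying
`w w^⋆ w` instead of `w` gives the same word and costs exactly `f w` more, whatever irreducible word
it is applied to. It rests on two lemmas saying that a tight word overlaps a left side only in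
trivial ways (`Tight.overlap`, `Tight.overlap_bar`). Consequently the total cost of reducing a word
is an invariant `P` as above that takes the value `f w` on the relation of a tight word `w`. With
`f` the indicator of the pair `{w, w^⋆}`, this shows that the classes of these pairs are a basis
of `ℤ ⊗ K`.

The image of a tight relation in `ℤ ⊗ ℤM^(X ⊔ X_⋆)` is a combination of the images of the relations
`x x^⋆ x = x`, `x ∈ X`, and the latter are linearly independent. So the kernel has one basis element
for each pair of tight words of length at least two.
-/

/-! ### Words, irreducible words and tight words -/

namespace FreeRegularStar

variable {X : Type}

/-- The formal involution on words, written on lists. -/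
def bar (w : List (X ⊕ X)) : List (X ⊕ X) := (w.map Sum.swap).reverse

@[simp] theorem bar_nil : bar ([] : List (X ⊕ X)) = [] := rfl

@[simp] theorem bar_append (u v : List (X ⊕ X)) : bar (u ++ v) = bar v ++ bar u := by
  simp [bar]

@[simp] theorem bar_bar (u : List (X ⊕ X)) : bar (bar u) = u := by
  simp [bar, List.map_reverse]

@[simp] theorem length_bar (u : List (X ⊕ X)) : (bar u).length = u.length := by
  simp [bar]

@[simp] theorem bar_eq_nil {u : List (X ⊕ X)} : bar u = [] ↔ u = [] := by
  simp [bar]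

theorem bar_eq_iff {u v : List (X ⊕ X)} : bar u = v ↔ u = bar v :=
  ⟨fun h => by rw [← h, bar_bar], fun h => by rw [h, bar_bar]⟩

/-- A word is irreducible if it has no factor `v v^⋆ v` with `v` nonempty, that is, if no
defining relation shortens it. -/
def Irred (n : List (X ⊕ X)) : Prop :=
  ∀ v, v ≠ [] → ¬ v ++ (bar v ++ v) <:+: n

theorem Irred.of_infix {m n : List (X ⊕ X)} (hn : Irred n) (h : m <:+: n) : Irred m :=
  fun v hv hm => hn v hv (hm.trans h)

theorem irred_nil : Irred ([] : List (X ⊕ X)) := fun v hv h => hv (by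
  have := List.infix_nil.1 h
  simp at this
  exact this)

theorem bar_infix {u v : List (X ⊕ X)} (h : u <:+: v) : bar u <:+: bar v := by
  obtain ⟨a, b, rfl⟩ := h
  exact ⟨bar b, bar a, by simp⟩

theorem irred_bar {n : List (X ⊕ X)} (hn : Irred n) : Irred (bar n) := fun v hv h => by
  have := bar_infix h
  simp only [bar_append, bar_bar, List.append_assoc] at this
  exact hn (bar v) (by simpa using hv) (by simpa using this)

/-- A word is tight if it is nonempty, irreducible, and neither begins nor ends with a word
`s s^⋆`, `s` nonempty. -/
structure Tight (w : List (X ⊕ X)) : Prop where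
  ne_nil : w ≠ []
  irred : Irred w
  not_prefix : ∀ s, s ≠ [] → ¬ s ++ bar s <+: w
  not_suffix : ∀ s, s ≠ [] → ¬ s ++ bar s <:+ w

theorem tight_bar {w : List (X ⊕ X)} (hw : Tight w) : Tight (bar w) where
  ne_nil := by simpa using hw.ne_nil
  irred := irred_bar hw.irred
  not_prefix s hs := by
    rintro ⟨t, ht⟩
    exact hw.not_suffix s hs ⟨bar t, by
      rw [eq_comm, bar_eq_iff] at ht; simp [ht]⟩
  not_suffix s hs := by
    rintro ⟨t, ht⟩
    exact hw.not_prefix s hs ⟨bar t, by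
      rw [eq_comm, bar_eq_iff] at ht; simp [ht]⟩

/-! ### Overlaps with tight words -/

/-- If a suffix `a` of a tight word meets a left side `v v^⋆ v` from the left, then `a` is already
covered by the first factor `v`. -/
theorem Tight.overlap {w a n v z b : List (X ⊕ X)} (hw : Tight w) (hwa : w = b ++ a)
    (hv : v ≠ []) (h : a ++ n = v ++ (bar v ++ (v ++ z))) :
    ∃ t, v = a ++ t ∧ n = t ++ (bar v ++ (v ++ z)) := by
  rcases List.append_eq_append_iff.1 h with ⟨t, h1, h2⟩ | ⟨t, h1, h2⟩
  · exact ⟨t, h1, h2⟩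
  rcases List.append_eq_append_iff.1 h2.symm with ⟨q, h3, h4⟩ | ⟨q, h3, h4⟩
  · rw [bar_eq_iff] at h3
    by_cases ht : t = []
    · subst ht
      exact ⟨[], by simp [h1], by simpa using h2.symm⟩
    · exact absurd ⟨b ++ bar q, by simp [hwa, h1, h3]⟩
        (hw.not_suffix (bar t) (by simpa using ht))
  exfalso
  rcases List.append_eq_append_iff.1 h4.symm with ⟨r, h5, h6⟩ | ⟨r, h5, h6⟩
  · by_cases hq : q = []
    · exact hw.not_suffix v hv ⟨b, by simp [hwa, h1, h3, hq]⟩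
    · exact hw.not_suffix (bar q) (by simpa using hq)
        ⟨b ++ (q ++ (r ++ bar r)), by simp [hwa, h1, h3, h5]⟩
  · exact hw.irred v hv ⟨b, r, by simp [hwa, h1, h3, h5]⟩

/-- If `w` is tight and `w n` is irreducible, then multiplying `w n` on the left by the letters of
`w^⋆` creates a left side only once all of `w^⋆` has been read, and then it is `w^⋆ w w^⋆`. -/
theorem Tight.overlap_bar {w a b n v z : List (X ⊕ X)} (hw : Tight w) (hwa : w = a ++ b)
    (ha : a ≠ []) (hn : Irred (w ++ n)) (hv : v ≠ [])
    (h : bar a ++ (w ++ n) = v ++ (bar v ++ (v ++ z))) :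
    b = [] ∧ v = bar w ∧ n = bar w ++ z := by
  obtain ⟨t, h1, h2⟩ := (tight_bar hw).overlap (b := bar b) (by simp [hwa]) hv h
  have hva : bar v = bar t ++ a := by simp [h1]
  -- otherwise `v^⋆ v` contains `a^⋆ a a^⋆`
  have hA : ∀ q, t ≠ w ++ q := by
    rintro q rfl
    refine absurd ⟨w ++ (q ++ (bar q ++ bar b)), w ++ (q ++ z), ?_⟩
      (hn (bar a) (by simpa using ha))
    rw [h2, hva, h1]
    simp [hwa]
  have htnil : t = [] := by
    by_contra ht
    rcases List.append_eq_append_iff.1 h2 with ⟨q, h3, -⟩ | ⟨q, h3, h4⟩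
    · exact hA q h3
    have hq : q ≠ [] := by
      rintro rfl
      exact hA [] (by simp [h3])
    rw [hva, List.append_assoc] at h4
    rcases List.append_eq_append_iff.1 h4 with ⟨r, h5, -⟩ | ⟨r, h5, -⟩
    · exact hw.not_prefix t ht ⟨r, by simp [h3, h5]⟩
    · rw [bar_eq_iff] at h5
      exact hw.not_suffix (bar q) (by simpa using hq)
        ⟨bar r, by simp [h3, h5]⟩
  subst htnil
  rw [List.append_nil] at h1
  subst h1
  have h6 : b ++ n = bar a ++ z := by
    simpa [hwa] using h2
  rcases List.append_eq_append_iff.1 h6 with ⟨r, h7, h8⟩ | ⟨r, h7, -⟩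
  · have hb : b = [] := by
      by_contra hb
      have h9 := bar_eq_iff.1 h7
      exact hw.not_suffix (bar b) (by simpa using hb)
        ⟨bar r, by simp [hwa, h9]⟩
    subst hb
    simp_all
  · exact absurd ⟨r, by simp [hwa, h7]⟩ (hw.not_prefix a ha)

/-! ### The left action on irreducible words -/

section Action

variable {B : Type} [AddCommGroup B] (f : List (X ⊕ X) → B)

/-- `v` and `z` exhibit a left side at the beginning of `m`: `m = v v^⋆ v z` with `v ≠ 1`. -/
def Starts (m : List (X ⊕ X)) (p : List (X ⊕ X) × List (X ⊕ X)) : Prop :=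
  p.1 ≠ [] ∧ m = p.1 ++ (bar p.1 ++ (p.1 ++ p.2))

open Classical in
/-- Multiplication of an irreducible word by a letter on the left: if a left side `v v^⋆ v` appears
at the beginning, it is replaced by `v`. -/
noncomputable def step (x : X ⊕ X) (n : List (X ⊕ X)) : List (X ⊕ X) :=
  if h : ∃ p, Starts (x :: n) p then h.choose.1 ++ h.choose.2 else x :: n

open Classical in
/-- The weight `f v` of the relation `v v^⋆ v = v` applied by `step`, or `0` if there is none. -/
noncomputable def stepCost (x : X ⊕ X) (n : List (X ⊕ X)) : B :=
  if h : ∃ p, Starts (x :: n) p then f h.choose.1 else 0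

/-- The left action of words on irreducible words, letter by letter. -/
noncomputable def act (u n : List (X ⊕ X)) : List (X ⊕ X) := u.foldr step n

/-- The total weight of the relations used by `act u n`. -/
noncomputable def cost : List (X ⊕ X) → List (X ⊕ X) → B
  | [], _ => 0
  | x :: u, n => stepCost f x (act u n) + cost u n

@[simp] theorem act_nil (n : List (X ⊕ X)) : act [] n = n := rfl

@[simp] theorem act_cons (x : X ⊕ X) (u n : List (X ⊕ X)) :
    act (x :: u) n = step x (act u n) := rfl

theorem act_append (u v n : List (X ⊕ X)) : act (u ++ v) n = act u (act v n) := by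
  simp [act]

@[simp] theorem cost_nil (n : List (X ⊕ X)) : cost f [] n = 0 := rfl

@[simp] theorem cost_cons (x : X ⊕ X) (u n : List (X ⊕ X)) :
    cost f (x :: u) n = stepCost f x (act u n) + cost f u n := rfl

theorem cost_append (u v n : List (X ⊕ X)) :
    cost f (u ++ v) n = cost f u (act v n) + cost f v n := by
  induction u with
  | nil => simp
  | cons x u ih => simp [ih, act_append, add_assoc]

theorem step_cases (x : X ⊕ X) {n : List (X ⊕ X)} (hn : Irred n) :
    (Irred (x :: n) ∧ step x n = x :: n ∧ stepCost f x n = 0) ∨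
      ∃ v z, v ≠ [] ∧ x :: n = v ++ (bar v ++ (v ++ z)) ∧ step x n = v ++ z ∧
        stepCost f x n = f v := by
  by_cases h : ∃ p, Starts (x :: n) p
  · exact .inr ⟨_, _, h.choose_spec.1, h.choose_spec.2, by simp [step, h], by simp [stepCost, h]⟩
  · refine .inl ⟨fun v hv hi => ?_, by simp [step, h], by simp [stepCost, h]⟩
    rcases List.infix_cons_iff.1 hi with ⟨z, hz⟩ | hi
    · exact h ⟨(v, z), hv, by simp [← hz]⟩
    · exact hn v hv hi

theorem irred_of_cons_eq {x : X ⊕ X} {n v z : List (X ⊕ X)} (hn : Irred n) (hv : v ≠ [])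
    (h : x :: n = v ++ (bar v ++ (v ++ z))) : Irred (v ++ z) := by
  cases v with
  | nil => exact absurd rfl hv
  | cons y v =>
    simp only [List.cons_append, List.cons.injEq] at h
    exact hn.of_infix ⟨v ++ bar (y :: v), [], by simp [h.2]⟩

theorem irred_act {n : List (X ⊕ X)} (hn : Irred n) (u : List (X ⊕ X)) : Irred (act u n) := by
  induction u with
  | nil => exact hn
  | cons x u ih =>
    rcases step_cases (fun _ => (0 : ℤ)) x ih with ⟨h, h', -⟩ | ⟨v, z, hv, h, h', -⟩
    · rwa [act_cons, h']
    · rw [act_cons, h']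
      exact irred_of_cons_eq ih hv h

/-- Either `u n` is irreducible, or some suffix `b` of `u` is the first to create a left side. -/
theorem act_cases {n : List (X ⊕ X)} (hn : Irred n) (u : List (X ⊕ X)) :
    (Irred (u ++ n) ∧ act u n = u ++ n ∧ cost f u n = 0) ∨
      ∃ a b v z, u = a ++ b ∧ b ≠ [] ∧ v ≠ [] ∧ b ++ n = v ++ (bar v ++ (v ++ z)) ∧
        act b n = v ++ z ∧ cost f b n = f v := by
  induction u with
  | nil => exact .inl ⟨hn, rfl, rfl⟩
  | cons x u ih =>
    rcases ih with ⟨h1, h2, h3⟩ | ⟨a, b, v, z, h, h'⟩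
    · rcases step_cases f x h1 with ⟨h4, h5, h6⟩ | ⟨v, z, hv, h4, h5, h6⟩
      · exact .inl ⟨h4, by simp [h2, h5], by simp [h2, h3, h6]⟩
      · exact .inr ⟨[], x :: u, v, z, rfl, by simp, hv, h4, by simp [h2, h5],
          by simp [h2, h3, h6]⟩
    · exact .inr ⟨x :: a, b, v, z, by simp [h], h'⟩

theorem act_of_irred {u n : List (X ⊕ X)} (h : Irred (u ++ n)) :
    act u n = u ++ n ∧ cost f u n = 0 := by
  rcases act_cases f (h.of_infix (List.suffix_append u n).isInfix) u with
    ⟨-, h'⟩ | ⟨a, b, v, z, h1, -, hv, h3, -⟩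
  · exact h'
  · exact absurd ⟨a, z, by simp [h1, h3]⟩ (h v hv)

variable {f}

/-- For tight `w`, the word `w w^⋆` fixes every `w · n`, and the weight of this computation is
`f w`, whatever `n` is. -/
theorem Tight.act_mul_bar (hf : ∀ v, f (bar v) = f v) {w : List (X ⊕ X)} (hw : Tight w) :
    ∀ (k : ℕ) (n : List (X ⊕ X)), n.length < k → Irred n →
      act (w ++ bar w) (act w n) = act w n ∧
        cost f (w ++ bar w) (act w n) = f w := by
  intro k
  induction k with
  | zero => exact fun n hn => absurd hn (Nat.not_lt_zero _)
  | succ k ih =>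
    intro n hk hn
    rcases act_cases f hn w with ⟨h1, h2, -⟩ | ⟨a, b, v, z, h1, h2, hv, h3, h4, -⟩
    · rw [h2, act_append, cost_append]
      rcases act_cases f h1 (bar w) with ⟨h5, h6, h7⟩ | ⟨a, b, v, z, h5, h6, hv, h8, h9, h10⟩
      · -- `w^⋆ w n` is irreducible, so the only left side met is the full `w w^⋆ w`
        rw [h6, h7]
        rcases act_cases f h5 w with ⟨h8, -⟩ | ⟨a, b, v, z, h8, h9, hv, h10, h11, h12⟩
        · exact absurd ⟨[], n, by simp⟩ (h8 w hw.ne_nil)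
        · obtain ⟨h13, h14, h15⟩ := (tight_bar hw).overlap_bar (a := bar b) (b := bar a)
            (by simp [h8]) (by simpa using h9) h5 hv (by simpa using h10)
          rw [bar_eq_nil] at h13
          subst h13
          rw [List.nil_append] at h8
          subst h8
          rw [bar_bar] at h14 h15
          subst h14
          exact ⟨h11.trans h15.symm, by simp [h12]⟩
      · -- the left side `w^⋆ w w^⋆` is met while multiplying by `w^⋆`, so `n = w^⋆ z`
        obtain ⟨h13, h14, h15⟩ := hw.overlap_bar (a := bar b) (b := bar a)
          (by rw [← bar_append, ← h5, bar_bar]) (by simpa using h6) h1 hv (by simpa using h8)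
        rw [bar_eq_nil] at h13
        subst h13
        rw [List.nil_append] at h5
        subst h5
        subst h14
        rw [h9, h10, ← h15, h2, (act_of_irred f h1).2]
        exact ⟨rfl, by simp [hf]⟩
    · -- `w · n = w · n₁` for a proper suffix `n₁` of `n`
      obtain ⟨t, rfl, h6⟩ := hw.overlap h1 hv h3
      have hsuf : b ++ (t ++ z) <:+ n := ⟨t ++ bar (b ++ t), by simp [h6]⟩
      have hirr : Irred (b ++ (t ++ z)) := hn.of_infix hsuf.isInfix
      have h7 : act w n = act w (t ++ z) := by
        rw [h1, act_append, act_append, h4, (act_of_irred f hirr).1, List.append_assoc]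
      rw [h7]
      refine ih (t ++ z) ?_ (hirr.of_infix (List.suffix_append b _).isInfix)
      have := hsuf.length_le
      have : 0 < b.length := List.length_pos_of_ne_nil h2
      simp only [List.length_append] at *
      omega

end Action

/-! ### Tight relations generate -/

theorem starWord_eq (w : FreeMonoid (X ⊕ X)) :
    starWord w = FreeMonoid.ofList (bar w.toList) := rfl

/-- The form of `a b a = a` in which it rewrites inside longer right-nested products. -/
theorem mul_mul_mul_of_inner_inverse {Q : Type*} [Monoid Q] {a b : Q} (h : a * (b * a) = a)
    (y : Q) : a * (b * (a * y)) = a * y := by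
  rw [← mul_assoc b, ← mul_assoc, h]

/-- A monoid homomorphism on words that respects `w w^⋆ w = w` for tight `w` respects it for
all `w`. -/
theorem hom_relation_of_tight {Q : Type*} [Monoid Q] (π : FreeMonoid (X ⊕ X) →* Q)
    (hπ : ∀ w, Tight w → π (.ofList (w ++ (bar w ++ w))) = π (.ofList w))
    (k : ℕ) (w : List (X ⊕ X)) (hk : w.length < k) :
    π (.ofList (w ++ (bar w ++ w))) = π (.ofList w) := by
  induction k generalizing w with
  | zero => exact absurd hk (Nat.not_lt_zero _)
  | succ k ih =>
    by_cases hw : Tight w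
    · exact hπ w hw
    by_cases hnil : w = []
    · simp [hnil]
    have key : (∃ a v b, v ≠ [] ∧ w = a ++ (v ++ (bar v ++ (v ++ b)))) ∨
        (∃ s u, s ≠ [] ∧ w = s ++ (bar s ++ u)) ∨ (∃ s u, s ≠ [] ∧ w = u ++ (s ++ bar s)) := by
      by_contra! hcon
      refine hw ⟨hnil, ?_, ?_, ?_⟩
      · rintro v hv ⟨a, b, h⟩
        exact hcon.1 a v b hv (by simp [← h])
      · rintro s hs ⟨u, h⟩
        exact hcon.2.1 s u hs (by simp [← h])
      · rintro s hs ⟨u, h⟩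
        exact hcon.2.2 s u hs (by simp [← h])
    simp only [FreeMonoid.ofList_append, map_mul] at ih ⊢
    rcases key with ⟨a, v, b, hv, rfl⟩ | ⟨s, u, hs, rfl⟩ | ⟨s, u, hs, rfl⟩
    · have hv := List.length_pos_of_ne_nil hv
      simp only [List.length_append, length_bar] at hk
      have h1 := ih v (by omega)
      have h2 := ih (bar v) (by simp; omega)
      have h3 := ih (a ++ (v ++ b)) (by simp; omega)
      simp only [FreeMonoid.ofList_append, map_mul, bar_append, bar_bar, mul_assoc] at h1 h2 h3 ⊢
      have h1' := mul_mul_mul_of_inner_inverse h1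
      have h2' := mul_mul_mul_of_inner_inverse h2
      simp only [h1', h2', h3]
    · have hs := List.length_pos_of_ne_nil hs
      simp only [List.length_append, length_bar] at hk
      have h1 := ih s (by omega)
      have h3 := ih (bar s ++ u) (by simp; omega)
      simp only [FreeMonoid.ofList_append, map_mul, bar_append, bar_bar, mul_assoc] at h1 h3 ⊢
      have h1' := mul_mul_mul_of_inner_inverse h1
      simp only [h1', h3]
    · have hs := List.length_pos_of_ne_nil hs
      simp only [List.length_append, length_bar] at hk
      have h1 := ih s (by omega)
      have h3 := ih (u ++ s) (by simp; omega)
      simp only [FreeMonoid.ofList_append, map_mul, bar_append, bar_bar, mul_assoc] at h1 h3 ⊢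
      have h1' := mul_mul_mul_of_inner_inverse h1
      have h3' := congrArg (· * π (FreeMonoid.ofList (bar s))) h3
      simp only [mul_assoc] at h3'
      simp only [h1', h3']

/-! ### The potential of a word -/

section Potential

variable {B : Type} [AddCommGroup B] (f : List (X ⊕ X) → B)

/-- Two words are related if they act in the same way on irreducible words, with weights that
differ by a constant. It contains the defining relations of the free regular `⋆`-monoid. -/
def weightedCon : Con (FreeMonoid (X ⊕ X)) where
  r u v := ∃ c, ∀ n, Irred n → act u.toList n = act v.toList n ∧
    cost f u.toList n = cost f v.toList n + c
  iseqv :=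
    { refl := fun u => ⟨0, fun n _ => ⟨rfl, by simp⟩⟩
      symm := fun ⟨c, h⟩ => ⟨-c, fun n hn => ⟨(h n hn).1.symm, by simp [(h n hn).2]⟩⟩
      trans := fun ⟨c, h⟩ ⟨d, h'⟩ => ⟨d + c, fun n hn =>
        ⟨(h n hn).1.trans (h' n hn).1, by rw [(h n hn).2, (h' n hn).2, add_assoc]⟩⟩ }
  mul' := by
    rintro u u' v v' ⟨c, h⟩ ⟨d, h'⟩
    refine ⟨c + d, fun n hn => ?_⟩
    rw [FreeMonoid.toList_mul, FreeMonoid.toList_mul, act_append, act_append, cost_append,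
      cost_append, (h' n hn).1, (h' n hn).2]
    have := h _ (irred_act hn v'.toList)
    rw [this.1, this.2]
    exact ⟨rfl, by abel⟩

variable {f}

theorem weightedCon_of_mk_eq (hf : ∀ v, f (bar v) = f v) {u v : FreeMonoid (X ⊕ X)}
    (h : PresentedMonoid.mk (FreeRegularStarRel X) u = PresentedMonoid.mk _ v) :
    weightedCon f u v := by
  have hle : conGen (FreeRegularStarRel X) ≤ weightedCon f := by
    refine Con.conGen_le.2 ?_
    rintro _ w ⟨_, rfl, rfl⟩
    have := hom_relation_of_tight (weightedCon f).mk' (fun w hw => ?_) _ w.toList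
      (Nat.lt_succ_self _)
    · rw [mul_assoc]
      exact (Con.eq _).1 this
    · refine (Con.eq _).2 ⟨f w, fun n hn => ?_⟩
      have := hw.act_mul_bar hf _ n (Nat.lt_succ_self _) hn
      simp only [FreeMonoid.toList_ofList]
      rw [← List.append_assoc, act_append, cost_append, this.1, this.2]
      exact ⟨rfl, add_comm _ _⟩
  exact hle ((Con.eq _).1 h)

variable (f)

/-- The total weight of the relations used to reduce a word to normal form. -/
noncomputable def potential (u : FreeMonoid (X ⊕ X)) : B := cost f u.toList []

variable {f}

theorem potential_mul_left (hf : ∀ v, f (bar v) = f v) {u v : FreeMonoid (X ⊕ X)}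
    (h : PresentedMonoid.mk (FreeRegularStarRel X) u = PresentedMonoid.mk _ v)
    (y : FreeMonoid (X ⊕ X)) :
    potential f (y * u) - potential f (y * v) = potential f u - potential f v := by
  obtain ⟨c, hc⟩ := weightedCon_of_mk_eq hf h
  simp only [potential, FreeMonoid.toList_mul, cost_append, (hc _ irred_nil).1]
  abel

theorem potential_mul_right (hf : ∀ v, f (bar v) = f v) {u v : FreeMonoid (X ⊕ X)}
    (h : PresentedMonoid.mk (FreeRegularStarRel X) u = PresentedMonoid.mk _ v)
    (y : FreeMonoid (X ⊕ X)) :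
    potential f (u * y) - potential f (v * y) = potential f u - potential f v := by
  obtain ⟨c, hc⟩ := weightedCon_of_mk_eq hf h
  simp only [potential, FreeMonoid.toList_mul, cost_append, (hc _ irred_nil).2,
    (hc _ (irred_act irred_nil y.toList)).2]
  abel

theorem Tight.potential_sub (hf : ∀ v, f (bar v) = f v) {w : List (X ⊕ X)} (hw : Tight w) :
    potential f (.ofList (w ++ (bar w ++ w))) - potential f (.ofList w) = f w := by
  have := hw.act_mul_bar hf _ [] (Nat.lt_succ_self _) irred_nil
  simp only [potential, FreeMonoid.toList_ofList]
  rw [← List.append_assoc, cost_append, this.2]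
  abel

end Potential

end FreeRegularStar

/-! ### Projective resolutions with a prescribed beginning -/

namespace MonoidHomology

section Resolution

open CategoryTheory Limits

universe v u

variable {C : Type u} [Category.{v} C] [Abelian C]

/-- An exact augmented complex of projective objects is a projective resolution. -/
noncomputable def resolutionOfExact {Z : C} (K : ChainComplex C ℕ) (hK : ∀ n, Projective (K.X n))
    (hexK : ∀ n, K.ExactAt (n + 1)) (p : K.X 0 ⟶ Z) [Epi p] (w : K.d 1 0 ≫ p = 0)
    (hex : (ShortComplex.mk (K.d 1 0) p w).Exact) : ProjectiveResolution Z where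
  complex := K
  projective := hK
  π := (ChainComplex.toSingle₀Equiv _ _).symm ⟨p, w⟩
  quasiIso := ⟨fun n => by
    cases n
    · rw [ChainComplex.quasiIsoAt₀_iff, ShortComplex.quasiIso_iff_of_zeros']
      · refine (ShortComplex.exact_and_epi_g_iff_of_iso (S₂ := ShortComplex.mk (K.d 1 0) p w)
          ?_).2 ⟨hex, inferInstance⟩
        refine ShortComplex.isoMk (Iso.refl (K.X 1)) (Iso.refl (K.X 0)) (Iso.refl Z) ?_ ?_
        · exact (Category.id_comp _).trans (Category.comp_id _).symm
        · refine (Category.id_comp _).trans (Eq.trans ?_ (Category.comp_id _).symm)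
          exact (ChainComplex.toSingle₀Equiv_symm_apply_f_zero p w).symm
      · exact K.shape 0 0 (by simp)
      all_goals rfl
    · rw [quasiIsoAt_iff_exactAt']
      · apply hexK
      · apply ChainComplex.exactAt_succ_single_obj⟩

variable [EnoughProjectives C]

/-- A morphism from a projective object onto the kernel of `f`. -/
noncomputable def kernelCover {X Y : C} (f : X ⟶ Y) : Projective.over (kernel f) ⟶ X :=
  Projective.π (kernel f) ≫ kernel.ι f

theorem kernelCover_comp {X Y : C} (f : X ⟶ Y) : kernelCover f ≫ f = 0 := by
  rw [kernelCover, Category.assoc, kernel.condition, comp_zero]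

theorem kernelCover_exact {X Y : C} (f : X ⟶ Y) :
    (ShortComplex.mk (kernelCover f) f (kernelCover_comp f)).Exact := by
  let α : ShortComplex.mk (kernelCover f) f (kernelCover_comp f) ⟶
      ShortComplex.mk (kernel.ι f) f (kernel.condition f) :=
    { τ₁ := Projective.π _
      τ₂ := 𝟙 _
      τ₃ := 𝟙 _
      comm₁₂ := (Category.comp_id _).symm
      comm₂₃ := (Category.id_comp _).trans (Category.comp_id _).symm }
  have : Epi α.τ₁ := inferInstanceAs (Epi (Projective.π _))
  have : IsIso α.τ₂ := inferInstanceAs (IsIso (𝟙 _))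
  have : Mono α.τ₃ := inferInstanceAs (Mono (𝟙 _))
  rw [ShortComplex.exact_iff_of_epi_of_isIso_of_mono α]
  apply ShortComplex.exact_of_f_is_kernel
  exact kernelIsKernel f

/-- The chain complex `⋯ → X₁ → X₀` obtained from `d : X₁ ⟶ X₀` by covering the successive kernels
by projective objects. -/
noncomputable def kernelCoverComplex {X₀ X₁ : C} (d : X₁ ⟶ X₀) : ChainComplex C ℕ :=
  ChainComplex.mk' X₀ X₁ d (fun f => ⟨_, kernelCover f, kernelCover_comp f⟩)

theorem kernelCoverComplex_d_one_zero {X₀ X₁ : C} (d : X₁ ⟶ X₀) :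
    (kernelCoverComplex d).d 1 0 = d := ChainComplex.mk'_d_1_0 _ _ _ _

theorem kernelCoverComplex_exactAt_succ {X₀ X₁ : C} (d : X₁ ⟶ X₀) (n : ℕ) :
    (kernelCoverComplex d).ExactAt (n + 1) := by
  rw [HomologicalComplex.exactAt_iff' _ (n + 1 + 1) (n + 1) n (by simp) (by simp)]
  refine ShortComplex.exact_of_iso ?_ (kernelCover_exact ((kernelCoverComplex d).d (n + 1) n))
  refine ShortComplex.isoMk
    (ChainComplex.mk'XIso X₀ X₁ d (fun f => ⟨_, kernelCover f, kernelCover_comp f⟩) n).symm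
    (Iso.refl _) (Iso.refl _) ?_ ?_
  · exact ((Iso.inv_comp_eq _).2
      (ChainComplex.mk'_d X₀ X₁ d (fun f => ⟨_, kernelCover f, kernelCover_comp f⟩) n)).trans
        (Category.comp_id _).symm
  · exact (Category.id_comp _).trans (Category.comp_id _).symm

theorem kernelCoverComplex_projective {X₀ X₁ : C} [Projective X₀] [Projective X₁] (d : X₁ ⟶ X₀) :
    ∀ n, Projective ((kernelCoverComplex d).X n)
  | 0 => ‹Projective X₀›
  | 1 => ‹Projective X₁›
  | n + 2 => Projective.of_iso
      (ChainComplex.mk'XIso X₀ X₁ d (fun f => ⟨_, kernelCover f, kernelCover_comp f⟩) n).symm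
      (Projective.projective_over _)

/-- An exact sequence `X₁ ⟶ X₀ ⟶ Z ⟶ 0` with `X₀` and `X₁` projective is the beginning of a
projective resolution of `Z`. -/
noncomputable def resolutionOfPresentation {Z X₀ X₁ : C} [Projective X₀] [Projective X₁]
    (d : X₁ ⟶ X₀) (p : X₀ ⟶ Z) [Epi p] (w : d ≫ p = 0) (hex : (ShortComplex.mk d p w).Exact) :
    ProjectiveResolution Z :=
  have hd := kernelCoverComplex_d_one_zero d
  have : Epi (Y := Z) (X := (kernelCoverComplex d).X 0) p := ‹Epi p›
  resolutionOfExact (kernelCoverComplex d) (kernelCoverComplex_projective d)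
    (kernelCoverComplex_exactAt_succ d) p (by rw [hd]; exact w) (by simp only [hd]; exact hex)

theorem resolutionOfPresentation_d {Z X₀ X₁ : C} [Projective X₀] [Projective X₁]
    (d : X₁ ⟶ X₀) (p : X₀ ⟶ Z) [Epi p] (w : d ≫ p = 0) (hex : (ShortComplex.mk d p w).Exact) :
    (resolutionOfPresentation d p w hex).complex.d 1 0 = d :=
  kernelCoverComplex_d_one_zero d

end Resolution

end MonoidHomology

namespace MonoidHomology

/-! ### The second homology group -/

/-- To identify the homology of a complex of modules with `B`, it suffices to give a map from the
chains to `B` that vanishes exactly on the boundaries among the cycles and maps the cycles onto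
`B`. -/
theorem nonempty_homology_equiv {R : Type} [CommRing R] (S : ShortComplex (ModuleCat.{0} R))
    {B : Type} [AddCommGroup B] [Module R B] (φ : S.X₂ →ₗ[R] B)
    (hf : ∀ x, φ (S.f.hom x) = 0) (hsurj : ∀ b, ∃ x, S.g.hom x = 0 ∧ φ x = b)
    (hinj : ∀ x, S.g.hom x = 0 → φ x = 0 → ∃ y, S.f.hom y = x) :
    Nonempty (S.homology ≃ₗ[R] B) := by
  let ψ : LinearMap.ker S.g.hom →ₗ[R] B := φ.comp (LinearMap.ker S.g.hom).subtype
  have hψ : Function.Surjective ψ := fun b => by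
    obtain ⟨x, hx, rfl⟩ := hsurj b
    exact ⟨⟨x, hx⟩, rfl⟩
  have hker : LinearMap.range S.moduleCatToCycles = LinearMap.ker ψ := by
    ext ⟨x, hx⟩
    constructor
    · rintro ⟨y, hy⟩
      have hy' : S.f.hom y = x := congrArg Subtype.val hy
      exact (congrArg φ hy').symm.trans (hf y)
    · intro h
      obtain ⟨y, hy⟩ := hinj x hx h
      exact ⟨y, Subtype.ext hy⟩
  exact ⟨S.moduleCatHomologyIso.toLinearEquiv.trans
    ((Submodule.quotEquivOfEq _ _ hker).trans (ψ.quotKerEquivOfSurjective hψ))⟩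

theorem finite_homology {R : Type} [CommRing R] [IsNoetherianRing R]
    (S : ShortComplex (ModuleCat.{0} R)) [Module.Finite R S.X₂] : Module.Finite R S.homology := by
  have : Module.Finite R (LinearMap.ker S.g.hom ⧸ LinearMap.range S.moduleCatToCycles) :=
    inferInstance
  let e : (LinearMap.ker S.g.hom ⧸ LinearMap.range S.moduleCatToCycles) ≃ₗ[R] S.homology :=
    S.moduleCatHomologyIso.toLinearEquiv.symm
  exact Module.Finite.equiv e

section

variable {M : Type} [Monoid M]

/-- The homology group `H_n(M, ℤ)` computed by a projective resolution. -/
noncomputable def integralHomologyIso (n : ℕ) (P : ProjectiveResolution (trivialModule M)) :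
    integralHomology (n + 1) M ≅ ((((trivialTensor M).mapHomologicalComplex _).obj P.complex).sc'
      (n + 2) (n + 1) n).homology :=
  P.isoLeftDerivedObj (trivialTensor M) (n + 1) ≪≫
    HomologicalComplex.homologyIsoSc' _ (n + 2) (n + 1) n (by simp) (by simp)

@[simp] theorem augmentation_of (m : M) : augmentation M (MonoidAlgebra.of ℤ M m) = 1 := by
  simp [augmentation]

theorem smul_sub_mem_coinvariantsKer (V : ModuleCat.{0} (MonoidAlgebra ℤ M))
    (a : MonoidAlgebra ℤ M) (v : V) : a • v - augmentation M a • v ∈ coinvariantsKer M V := by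
  induction a using MonoidAlgebra.induction_on with
  | of m => exact Submodule.subset_span ⟨m, v, by rw [augmentation_of, one_smul]⟩
  | add a b ha hb =>
    have := add_mem ha hb
    rw [map_add, add_smul, add_smul]
    convert this using 1
    abel
  | smul r a ha =>
    have := Submodule.smul_mem _ r ha
    rw [map_zsmul, smul_assoc, smul_assoc, ← smul_sub]
    exact this

theorem finite_trivialTensor (V : ModuleCat.{0} (MonoidAlgebra ℤ M))
    [Module.Finite (MonoidAlgebra ℤ M) V] : Module.Finite ℤ ((trivialTensor M).obj V) := by
  obtain ⟨s, hs⟩ := Module.Finite.fg_top (R := MonoidAlgebra ℤ M) (M := V)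
  classical
  refine ⟨⟨s.image (coinvariantsKer M V).mkQ, ?_⟩⟩
  rw [eq_top_iff]
  rintro x -
  obtain ⟨v, rfl⟩ := (coinvariantsKer M V).mkQ_surjective x
  have hv : v ∈ Submodule.span (MonoidAlgebra ℤ M) (s : Set V) := hs ▸ Submodule.mem_top
  induction hv using Submodule.span_induction with
  | mem v hv => exact Submodule.subset_span (Finset.mem_coe.2 (Finset.mem_image_of_mem _ hv))
  | zero => rw [map_zero]; exact zero_mem _
  | add v w _ _ hv hw => rw [map_add]; exact add_mem hv hw
  | smul a v _ hv =>
    have : (coinvariantsKer M V).mkQ (a • v) =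
        augmentation M a • (coinvariantsKer M V).mkQ v := by
      rw [← map_smul]
      exact (Submodule.Quotient.eq _).2 (smul_sub_mem_coinvariantsKer V a v)
    rw [this]
    exact Submodule.smul_mem _ _ hv

theorem finite_integralHomology_of_isFP {n : ℕ} (h : IsFP (n + 1) M) :
    Module.Finite ℤ (integralHomology (n + 1) M) := by
  obtain ⟨P, hP⟩ := h
  have := hP (n + 1) (by omega) le_rfl
  have : Module.Finite ℤ ((((trivialTensor M).mapHomologicalComplex _).obj P.complex).sc'
      (n + 2) (n + 1) n).X₂ := finite_trivialTensor (P.complex.X (n + 1))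
  have := finite_homology ((((trivialTensor M).mapHomologicalComplex _).obj P.complex).sc'
      (n + 2) (n + 1) n)
  exact Module.Finite.equiv (integralHomologyIso n P).toLinearEquiv.symm

/-- A description of `H₂(M, ℤ)` through a projective resolution: an additive map `Ψ` on the module
in degree one that is invariant on the kernel `K` of the differential identifies `H₂(M, ℤ)`, the
kernel of `ℤ ⊗ K → ℤ ⊗ P₁`, with the group `B`. -/
theorem nonempty_integralHomology_two_equiv (P : ProjectiveResolution (trivialModule M))
    {B : Type} [AddCommGroup B] [Module ℤ B] (Ψ : P.complex.X 1 →ₗ[ℤ] B)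
    (hΨ : ∀ (m : M) k, (P.complex.d 1 0).hom k = 0 → Ψ (MonoidAlgebra.of ℤ M m • k) = Ψ k)
    (hsurj : ∀ b, ∃ k, (P.complex.d 1 0).hom k = 0 ∧ k ∈ coinvariantsKer M (P.complex.X 1) ∧
      Ψ k = b)
    (hinj : ∀ k, (P.complex.d 1 0).hom k = 0 → k ∈ coinvariantsKer M (P.complex.X 1) → Ψ k = 0 →
      k ∈ Submodule.span ℤ {y | ∃ (m : M) (k' : P.complex.X 1), (P.complex.d 1 0).hom k' = 0 ∧
        y = MonoidAlgebra.of ℤ M m • k' - k'}) :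
    Nonempty (integralHomology 2 M ≃ₗ[ℤ] B) := by
  have hdd : ∀ x, (P.complex.d 1 0).hom ((P.complex.d 2 1).hom x) = 0 := fun x =>
    congrArg (fun f => f.hom x) (P.complex.d_comp_d 2 1 0)
  have hdd' : ∀ x, (P.complex.d 2 1).hom ((P.complex.d 3 2).hom x) = 0 := fun x =>
    congrArg (fun f => f.hom x) (P.complex.d_comp_d 3 2 1)
  have hex1 : ∀ k, (P.complex.d 1 0).hom k = 0 → ∃ x, (P.complex.d 2 1).hom x = k := fun k hk =>
    (ShortComplex.moduleCat_exact_iff _).1 (P.exact_succ 0) k hk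
  have hex2 : ∀ k, (P.complex.d 2 1).hom k = 0 → ∃ x, (P.complex.d 3 2).hom x = k := fun k hk =>
    (ShortComplex.moduleCat_exact_iff _).1 (P.exact_succ 1) k hk
  let Φ : P.complex.X 2 →ₗ[ℤ] B := Ψ.comp (P.complex.d 2 1).hom.toAddMonoidHom.toIntLinearMap
  have hΦ : coinvariantsKer M (P.complex.X 2) ≤ LinearMap.ker Φ := by
    refine Submodule.span_le.2 ?_
    rintro _ ⟨m, v, rfl⟩
    change Φ (_ - v) = 0
    rw [map_sub, sub_eq_zero]
    change Ψ ((P.complex.d 2 1).hom _) = Ψ ((P.complex.d 2 1).hom v)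
    rw [map_smul]
    exact hΨ m _ (hdd v)
  suffices h : Nonempty (((((trivialTensor M).mapHomologicalComplex _).obj P.complex).sc'
      3 2 1).homology ≃ₗ[ℤ] B) from
    h.map fun e => (integralHomologyIso 1 P).toLinearEquiv.trans e
  refine nonempty_homology_equiv
    ((((trivialTensor M).mapHomologicalComplex _).obj P.complex).sc' 3 2 1)
    ((coinvariantsKer M (P.complex.X 2)).liftQ Φ hΦ) (fun x => ?_) (fun b => ?_)
    (fun x hx hx' => ?_)
  · obtain ⟨v, rfl⟩ := Submodule.Quotient.mk_surjective _ x
    change Ψ ((P.complex.d 2 1).hom ((P.complex.d 3 2).hom v)) = 0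
    rw [hdd', map_zero]
  · obtain ⟨k, hk, hk', rfl⟩ := hsurj b
    obtain ⟨x, rfl⟩ := hex1 k hk
    exact ⟨Submodule.Quotient.mk x, (Submodule.Quotient.mk_eq_zero _).2 hk', rfl⟩
  · obtain ⟨v, rfl⟩ := Submodule.Quotient.mk_surjective _ x
    have hv : (P.complex.d 2 1).hom v ∈ coinvariantsKer M (P.complex.X 1) :=
      (Submodule.Quotient.mk_eq_zero _).1 hx
    have hv' := hinj _ (hdd v) hv hx'
    -- correcting `v` by elements `m • x - x` makes it a cycle, hence a boundary
    have key : ∀ k ∈ Submodule.span ℤ {y | ∃ (m : M) (k' : P.complex.X 1),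
        (P.complex.d 1 0).hom k' = 0 ∧ y = MonoidAlgebra.of ℤ M m • k' - k'},
        ∃ x ∈ coinvariantsKer M (P.complex.X 2), (P.complex.d 2 1).hom x = k := by
      intro k hk
      induction hk using Submodule.span_induction with
      | mem k hk =>
        obtain ⟨m, k', hk', rfl⟩ := hk
        obtain ⟨x, rfl⟩ := hex1 k' hk'
        exact ⟨_, Submodule.subset_span ⟨m, x, rfl⟩, by rw [map_sub, map_smul]⟩
      | zero => exact ⟨0, zero_mem _, map_zero _⟩
      | add k l _ _ hk hl =>
        obtain ⟨x, hx, rfl⟩ := hk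
        obtain ⟨y, hy, rfl⟩ := hl
        exact ⟨x + y, add_mem hx hy, map_add _ _ _⟩
      | smul r k _ hk =>
        obtain ⟨x, hx, rfl⟩ := hk
        exact ⟨r • x, Submodule.smul_mem _ r hx, map_zsmul _ _ _⟩
    obtain ⟨x, hx, hxv⟩ := key _ hv'
    obtain ⟨y, hy⟩ := hex2 (v - x) (by rw [map_sub, hxv, sub_self])
    refine ⟨Submodule.Quotient.mk y, (Submodule.Quotient.eq _).2 ?_⟩
    change (P.complex.d 3 2).hom y - v ∈ _
    rw [hy, sub_sub_cancel_left]
    exact neg_mem hx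

end

end MonoidHomology

/-! ### Fox calculus over a monoid with given generators -/

namespace FreeRegularStar

open MonoidHomology

section Fox

variable {A M : Type} [Monoid M]

/-- The additive map `ℤM → B` extending a function on `M`. -/
noncomputable def linearExtension {B : Type} [AddCommGroup B] (g : M → B) :
    MonoidAlgebra ℤ M →ₗ[ℤ] B :=
  (Finsupp.linearCombination ℤ g).comp (MonoidAlgebra.coeffLinearEquiv ℤ).toLinearMap

@[simp] theorem linearExtension_of {B : Type} [AddCommGroup B] (g : M → B) (m : M) :
    linearExtension g (MonoidAlgebra.of ℤ M m) = g m := by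
  simp [linearExtension, MonoidAlgebra.of_apply]

variable (π : FreeMonoid A →* M)

/-- The first differential `e_a ↦ a - 1` of the Cayley graph resolution. Elements of
`A →₀ ℤM` are the 1-chains of the right Cayley graph of `M`. -/
noncomputable def foxBoundary : (A →₀ MonoidAlgebra ℤ M) →ₗ[MonoidAlgebra ℤ M] MonoidAlgebra ℤ M :=
  Finsupp.linearCombination _ fun a => MonoidAlgebra.of ℤ M (π (FreeMonoid.of a)) - 1

/-- The Fox derivative on lists of letters. -/
noncomputable def foxList : List A → (A →₀ MonoidAlgebra ℤ M)
  | [] => 0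
  | a :: u => Finsupp.single a 1 + MonoidAlgebra.of ℤ M (π (FreeMonoid.of a)) • foxList u

/-- The total Fox derivative of a word: the path from `1` labelled by the word, as a 1-chain. -/
noncomputable def fox (u : FreeMonoid A) : A →₀ MonoidAlgebra ℤ M := foxList π u.toList

@[simp] theorem fox_one : fox π 1 = 0 := rfl

@[simp] theorem fox_of (a : A) : fox π (FreeMonoid.of a) = Finsupp.single a 1 := by
  simp [fox, foxList]

theorem fox_mul (u v : FreeMonoid A) :
    fox π (u * v) = fox π u + MonoidAlgebra.of ℤ M (π u) • fox π v := by
  induction u using FreeMonoid.inductionOn' with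
  | one => rw [one_mul, fox_one, map_one, map_one, one_smul, zero_add]
  | of_mul a u ih =>
    have h : ∀ y, fox π (FreeMonoid.of a * y) =
        Finsupp.single a 1 + MonoidAlgebra.of ℤ M (π (FreeMonoid.of a)) • fox π y := fun y => rfl
    rw [mul_assoc, h, h, ih, map_mul, map_mul, smul_add, mul_smul, add_assoc]

theorem foxBoundary_fox (u : FreeMonoid A) :
    foxBoundary π (fox π u) = MonoidAlgebra.of ℤ M (π u) - 1 := by
  induction u using FreeMonoid.inductionOn' with
  | one => rw [fox_one, map_zero, map_one, map_one, sub_self]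
  | of_mul a u ih =>
    rw [fox_mul, map_add, map_smul, ih, fox_of]
    simp [foxBoundary, mul_sub]

theorem foxBoundary_fox_sub {u v : FreeMonoid A} (h : π u = π v) :
    foxBoundary π (fox π u - fox π v) = 0 := by
  rw [map_sub, foxBoundary_fox, foxBoundary_fox, h, sub_self]

theorem augmentation_foxBoundary (x : A →₀ MonoidAlgebra ℤ M) :
    augmentation M (foxBoundary π x) = 0 := by
  induction x using Finsupp.induction_linear with
  | zero => simp
  | add x y hx hy => rw [map_add, map_add, hx, hy, add_zero]
  | single a r => simp [foxBoundary, augmentation]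

variable {π}

theorem exists_foxBoundary_eq (hπ : Function.Surjective π) (r : MonoidAlgebra ℤ M) :
    ∃ x, foxBoundary π x = r - augmentation M r • 1 := by
  induction r using MonoidAlgebra.induction_on with
  | of m =>
    obtain ⟨u, rfl⟩ := hπ m
    exact ⟨fox π u, by rw [foxBoundary_fox, augmentation_of, one_smul]⟩
  | add a b ha hb =>
    obtain ⟨x, hx⟩ := ha
    obtain ⟨y, hy⟩ := hb
    exact ⟨x + y, by rw [map_add, hx, hy, map_add, add_smul]; abel⟩
  | smul n a ha =>
    obtain ⟨x, hx⟩ := ha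
    exact ⟨n • x, by rw [map_zsmul, hx, map_zsmul, smul_sub, smul_assoc]⟩

/-- Every 1-chain of the Cayley graph is an integral combination of edges `m e_a`. -/
theorem chain_induction {p : (A →₀ MonoidAlgebra ℤ M) → Prop} (hzero : p 0)
    (hedge : ∀ m a, p (Finsupp.single a (MonoidAlgebra.of ℤ M m)))
    (hadd : ∀ x y, p x → p y → p (x + y)) (hsmul : ∀ (n : ℤ) x, p x → p (n • x)) (x) : p x := by
  induction x using Finsupp.induction_linear with
  | zero => exact hzero
  | add x y hx hy => exact hadd x y hx hy
  | single a r =>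
    induction r using MonoidAlgebra.induction_on with
    | of m => exact hedge m a
    | add r s hr hs => rw [Finsupp.single_add]; exact hadd _ _ hr hs
    | smul n r hr => rw [← Finsupp.smul_single]; exact hsmul n _ hr

theorem fox_mul_of_sub {u : FreeMonoid A} (a : A) :
    fox π (u * FreeMonoid.of a) - fox π u = Finsupp.single a (MonoidAlgebra.of ℤ M (π u)) := by
  rw [fox_mul, add_sub_cancel_left, fox_of, Finsupp.smul_single, smul_eq_mul, mul_one]

/-- The 1-cycles of the Cayley graph are spanned by the differences of paths from `1` with the same
endpoint. -/
theorem mem_span_fox_sub (hπ : Function.Surjective π) {k : A →₀ MonoidAlgebra ℤ M}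
    (hk : foxBoundary π k = 0) :
    k ∈ Submodule.span ℤ {y | ∃ u v, π u = π v ∧ y = fox π u - fox π v} := by
  let σ := Function.surjInv hπ
  have hσ : ∀ m, π (σ m) = m := Function.surjInv_eq hπ
  -- `N` sends a vertex to a chosen path leading to it
  let N : MonoidAlgebra ℤ M →ₗ[ℤ] (A →₀ MonoidAlgebra ℤ M) := linearExtension fun m => fox π (σ m)
  have key : ∀ x, x - N (foxBoundary π x) ∈
      Submodule.span ℤ {y | ∃ u v, π u = π v ∧ y = fox π u - fox π v} := by
    refine fun x => chain_induction (p := fun x => x - N (foxBoundary π x) ∈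
      Submodule.span ℤ {y | ∃ u v, π u = π v ∧ y = fox π u - fox π v}) ?_ (fun m a => ?_)
      (fun x y hx hy => ?_) (fun n x hx => ?_) x
    · simp
    · have h1 : foxBoundary π (Finsupp.single a (MonoidAlgebra.of ℤ M m)) =
          MonoidAlgebra.of ℤ M (m * π (FreeMonoid.of a)) - MonoidAlgebra.of ℤ M m := by
        rw [foxBoundary, Finsupp.linearCombination_single, smul_eq_mul, mul_sub, mul_one, map_mul]
      have h2 := fox_mul_of_sub (π := π) (u := σ m) a
      rw [hσ] at h2
      rw [h1, map_sub, linearExtension_of, linearExtension_of, ← h2, sub_sub_sub_cancel_right]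
      exact Submodule.subset_span ⟨_, _, by rw [hσ, map_mul, hσ], rfl⟩
    · rw [map_add, map_add, add_sub_add_comm]
      exact add_mem hx hy
    · rw [map_zsmul, map_zsmul]
      convert Submodule.smul_mem _ n hx using 1
      exact (smul_sub n x _).symm
  have := key k
  rwa [hk, map_zero, sub_zero] at this

/-- A function on words whose differences along `π` are invariant under right multiplication
integrates to a function on 1-chains of the Cayley graph. -/
theorem exists_chain_map {B : Type} [AddCommGroup B] (hπ : Function.Surjective π)
    (P : FreeMonoid A → B)
    (hP : ∀ u v y, π u = π v → P (u * y) - P (v * y) = P u - P v) :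
    ∃ Ψ : (A →₀ MonoidAlgebra ℤ M) →ₗ[ℤ] B,
      ∀ u v, π u = π v → Ψ (fox π u - fox π v) = P u - P v := by
  let σ := Function.surjInv hπ
  have hσ : ∀ m, π (σ m) = m := Function.surjInv_eq hπ
  let Ψ : (A →₀ MonoidAlgebra ℤ M) →ₗ[ℤ] B := Finsupp.lsum ℤ fun a =>
    linearExtension fun m => P (σ m * FreeMonoid.of a) - P (σ (m * π (FreeMonoid.of a)))
  have hΨ : ∀ m a, Ψ (Finsupp.single a (MonoidAlgebra.of ℤ M m)) =
      P (σ m * FreeMonoid.of a) - P (σ (m * π (FreeMonoid.of a))) := fun m a => by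
    simp only [Ψ, Finsupp.lsum_single, linearExtension_of]
  have key : ∀ u : List A, Ψ (fox π (FreeMonoid.ofList u)) =
      P (FreeMonoid.ofList u) - P (σ (π (FreeMonoid.ofList u))) - (P 1 - P (σ 1)) := by
    intro u
    induction u using List.reverseRecOn with
    | nil =>
      rw [FreeMonoid.ofList_nil, fox_one, map_zero, map_one, sub_self]
    | append_singleton u a ih =>
      have h1 : FreeMonoid.ofList (u ++ [a]) = FreeMonoid.ofList u * FreeMonoid.of a := rfl
      have h2 := fox_mul_of_sub (π := π) (u := FreeMonoid.ofList u) a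
      rw [sub_eq_iff_eq_add] at h2
      have h3 := hP (FreeMonoid.ofList u) (σ (π (FreeMonoid.ofList u))) (FreeMonoid.of a)
        (hσ _).symm
      rw [sub_eq_iff_eq_add] at h3
      rw [h1, h2, map_add, hΨ, ih, map_mul, h3]
      abel
  refine ⟨Ψ, fun u v h => ?_⟩
  have hu := key u.toList
  have hv := key v.toList
  rw [FreeMonoid.ofList_toList] at hu hv
  rw [map_sub, hu, hv, h]
  abel

/-! ### The abelianised chains -/

/-- The module of 1-chains as an object of the category of left `ℤM`-modules. -/
noncomputable abbrev chainModule (A M : Type) [Monoid M] : ModuleCat.{0} (MonoidAlgebra ℤ M) :=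
  ModuleCat.of _ (A →₀ MonoidAlgebra ℤ M)

/-- The identification `ℤ ⊗ (A →₀ ℤM) → (A →₀ ℤ)`, as a map on chains. -/
noncomputable def chainAugmentation (A M : Type) [Monoid M] :
    (A →₀ MonoidAlgebra ℤ M) →ₗ[ℤ] (A →₀ ℤ) :=
  Finsupp.mapRange.linearMap (augmentation M).toAddMonoidHom.toIntLinearMap

@[simp] theorem chainAugmentation_single (a : A) (r : MonoidAlgebra ℤ M) :
    chainAugmentation A M (Finsupp.single a r) = Finsupp.single a (augmentation M r) := by
  simp [chainAugmentation]

theorem chainAugmentation_smul (m : M) (x : A →₀ MonoidAlgebra ℤ M) :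
    chainAugmentation A M (MonoidAlgebra.of ℤ M m • x) = chainAugmentation A M x := by
  ext a
  simp [chainAugmentation, augmentation]

theorem mem_coinvariantsKer_chainModule {x : chainModule A M} :
    x ∈ coinvariantsKer M (chainModule A M) ↔ chainAugmentation A M x = 0 := by
  constructor
  · intro hx
    have : coinvariantsKer M (chainModule A M) ≤ LinearMap.ker (chainAugmentation A M) := by
      refine Submodule.span_le.2 ?_
      rintro _ ⟨m, v, rfl⟩
      exact (map_sub _ _ _).trans (sub_eq_zero.2 (chainAugmentation_smul m v))
    exact this hx
  · intro hx
    let ι : (A →₀ ℤ) →ₗ[ℤ] (A →₀ MonoidAlgebra ℤ M) :=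
      Finsupp.linearCombination ℤ fun a => Finsupp.single a 1
    have key : ∀ y : chainModule A M,
        y - ι (chainAugmentation A M y) ∈ coinvariantsKer M (chainModule A M) := by
      intro y
      refine Finsupp.induction_linear y ?_ (fun y z hy hz => ?_) (fun a r => ?_)
      · simp
      · rw [map_add, map_add, add_sub_add_comm]
        exact add_mem hy hz
      · have := smul_sub_mem_coinvariantsKer (chainModule A M) r (Finsupp.single a 1)
        rw [chainAugmentation_single, Finsupp.linearCombination_single]
        rwa [Finsupp.smul_single, smul_eq_mul, mul_one] at this
    have := key x
    rwa [hx, map_zero, sub_zero] at this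

theorem chainAugmentation_fox_mul (u v : FreeMonoid A) :
    chainAugmentation A M (fox π (u * v)) =
      chainAugmentation A M (fox π u) + chainAugmentation A M (fox π v) := by
  rw [fox_mul, map_add, chainAugmentation_smul]

/-! ### The Cayley graph resolution -/

/-- The augmentation as a morphism of left `ℤM`-modules. -/
noncomputable def augmentationHom (M : Type) [Monoid M] :
    ModuleCat.of (MonoidAlgebra ℤ M) (MonoidAlgebra ℤ M) ⟶ trivialModule M :=
  ModuleCat.ofHom (Y := trivialModule M)
    (LinearMap.toSpanSingleton (MonoidAlgebra ℤ M) (trivialModule M)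
      (show trivialModule M from (1 : ℤ)))

theorem augmentationHom_apply (r : MonoidAlgebra ℤ M) :
    (augmentationHom M).hom r = augmentation M r := by
  change augmentation M r * 1 = _
  rw [mul_one]

instance : Epi (augmentationHom M) := by
  rw [ModuleCat.epi_iff_surjective]
  intro (n : ℤ)
  refine ⟨(n • 1 : MonoidAlgebra ℤ M), (augmentationHom_apply _).trans ?_⟩
  rw [map_zsmul, map_one]
  exact mul_one n

theorem foxBoundary_comp_augmentationHom (π : FreeMonoid A →* M) :
    (ModuleCat.ofHom (foxBoundary π) : chainModule A M ⟶ _) ≫ augmentationHom M = 0 := by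
  refine ModuleCat.hom_ext (LinearMap.ext fun x => ?_)
  exact (augmentationHom_apply _).trans (augmentation_foxBoundary π x)

theorem foxBoundary_exact (hπ : Function.Surjective π) :
    (ShortComplex.mk _ _ (foxBoundary_comp_augmentationHom π)).Exact := by
  rw [ShortComplex.moduleCat_exact_iff]
  intro r hr
  obtain ⟨x, hx⟩ := exists_foxBoundary_eq hπ r
  have hr' : augmentation M r = 0 := (augmentationHom_apply r).symm.trans hr
  exact ⟨x, by rw [hr', zero_smul, sub_zero] at hx; exact hx⟩

/-- A description of `H₂(M, ℤ)` in terms of the cycle space of the Cayley graph of `M`. -/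
theorem nonempty_integralHomology_two_equiv_of_fox (hπ : Function.Surjective π)
    {B : Type} [AddCommGroup B] [Module ℤ B] (Ψ : (A →₀ MonoidAlgebra ℤ M) →ₗ[ℤ] B)
    (hΨ : ∀ (m : M) k, foxBoundary π k = 0 → Ψ (MonoidAlgebra.of ℤ M m • k) = Ψ k)
    (hsurj : ∀ b, ∃ k, foxBoundary π k = 0 ∧ chainAugmentation A M k = 0 ∧ Ψ k = b)
    (hinj : ∀ k, foxBoundary π k = 0 → chainAugmentation A M k = 0 → Ψ k = 0 →
      k ∈ Submodule.span ℤ {y | ∃ (m : M) (k' : A →₀ MonoidAlgebra ℤ M), foxBoundary π k' = 0 ∧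
        y = MonoidAlgebra.of ℤ M m • k' - k'}) :
    Nonempty (integralHomology 2 M ≃ₗ[ℤ] B) := by
  let d : chainModule A M ⟶ ModuleCat.of _ (MonoidAlgebra ℤ M) := ModuleCat.ofHom (foxBoundary π)
  have : Projective (chainModule A M) :=
    ModuleCat.projective_of_categoryTheory_projective _
  have : Projective (ModuleCat.of (MonoidAlgebra ℤ M) (MonoidAlgebra ℤ M)) :=
    ModuleCat.projective_of_categoryTheory_projective _
  let P := resolutionOfPresentation d _ (foxBoundary_comp_augmentationHom π) (foxBoundary_exact hπ)
  have hd : P.complex.d 1 0 = d := resolutionOfPresentation_d _ _ _ _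
  have hd' : ∀ k : chainModule A M, (P.complex.d 1 0).hom k = foxBoundary π k := fun k =>
    congrArg (fun f : chainModule A M ⟶ ModuleCat.of _ (MonoidAlgebra ℤ M) => f.hom k) hd
  refine nonempty_integralHomology_two_equiv P Ψ (fun m k hk => hΨ m k ((hd' k).symm.trans hk))
    (fun b => ?_) (fun k hk hk' h => ?_)
  · obtain ⟨k, hk, hk', rfl⟩ := hsurj b
    exact ⟨k, (hd' k).trans hk, mem_coinvariantsKer_chainModule.2 hk', rfl⟩
  · refine Submodule.span_mono ?_ (hinj k ((hd' k).symm.trans hk)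
      (mem_coinvariantsKer_chainModule.1 hk') h)
    rintro _ ⟨m, k', hk', rfl⟩
    exact ⟨m, k', (hd' k').trans hk', rfl⟩

end Fox

end FreeRegularStar

/-! ### The second homology of the free regular `⋆`-monoid -/

namespace FreeRegularStar

open MonoidHomology

variable {X : Type}

section Relations

/-- The quotient map from words to the free regular `⋆`-monoid. -/
abbrev quot (X : Type) : FreeMonoid (X ⊕ X) →* FreeRegularStarMonoid X :=
  PresentedMonoid.mk (FreeRegularStarRel X)

theorem quot_relation (w : List (X ⊕ X)) :
    quot X (.ofList (w ++ (bar w ++ w))) = quot X (.ofList w) :=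
  (Con.eq _).2 (ConGen.Rel.of _ _ ⟨.ofList w, by
    rw [starWord_eq, mul_assoc]; rfl, rfl⟩)

/-- The 1-chains of the Cayley graph of the free regular `⋆`-monoid. -/
abbrev Chains (X : Type) : Type := (X ⊕ X) →₀ MonoidAlgebra ℤ (FreeRegularStarMonoid X)

/-- The 1-cycle given by the relation `w w^⋆ w = w`. -/
noncomputable def relCycle (w : List (X ⊕ X)) : Chains X :=
  fox (quot X) (.ofList (w ++ (bar w ++ w))) - fox (quot X) (.ofList w)

/-- The elements `m • k - k`, with `k` a 1-cycle, generate the subgroup by which the 1-cycles are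
divided in forming their coinvariants. -/
noncomputable def cycleCoinvariantsKer (X : Type) : Submodule ℤ (Chains X) :=
  Submodule.span ℤ {y | ∃ (m : FreeRegularStarMonoid X) (k : Chains X),
    foxBoundary (quot X) k = 0 ∧ y = MonoidAlgebra.of ℤ _ m • k - k}

theorem foxBoundary_relCycle (w : List (X ⊕ X)) : foxBoundary (quot X) (relCycle w) = 0 :=
  foxBoundary_fox_sub _ (quot_relation w)

/-- Both ways of applying a relation to `w w^⋆ w w^⋆` give the same result. -/
theorem relCycle_bar_sub_mem (w : List (X ⊕ X)) :
    relCycle (bar w) - relCycle w ∈ cycleCoinvariantsKer X := by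
  have h1 : relCycle w = fox (quot X) (.ofList ((w ++ (bar w ++ w)) ++ bar w)) -
      fox (quot X) (.ofList (w ++ bar w)) := by
    rw [FreeMonoid.ofList_append (_ ++ _), FreeMonoid.ofList_append w (bar w), fox_mul, fox_mul,
      quot_relation, add_sub_add_right_eq_sub, relCycle]
  have h2 : MonoidAlgebra.of ℤ _ (quot X (.ofList w)) • relCycle (bar w) =
      fox (quot X) (.ofList ((w ++ (bar w ++ w)) ++ bar w)) -
      fox (quot X) (.ofList (w ++ bar w)) := by
    rw [List.append_assoc, FreeMonoid.ofList_append w, FreeMonoid.ofList_append w (bar w), fox_mul,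
      fox_mul, add_sub_add_left_eq_sub, relCycle, smul_sub, bar_bar, List.append_assoc]
  rw [← neg_mem_iff, neg_sub]
  exact Submodule.subset_span ⟨_, _, foxBoundary_relCycle (bar w), by rw [h2, ← h1]⟩

/-- The 1-cycles are spanned, up to coinvariants, by the tight relations. -/
theorem mem_sup_span_relCycle {k : Chains X} (hk : foxBoundary (quot X) k = 0) :
    k ∈ cycleCoinvariantsKer X ⊔ Submodule.span ℤ {y | ∃ w, Tight w ∧ y = relCycle w} := by
  set S := cycleCoinvariantsKer X ⊔ Submodule.span ℤ {y | ∃ w, Tight w ∧ y = relCycle w}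
  let c : Con (FreeMonoid (X ⊕ X)) :=
    { r := fun u v => quot X u = quot X v ∧ fox (quot X) u - fox (quot X) v ∈ S
      iseqv :=
        { refl := fun u => ⟨rfl, by rw [sub_self]; exact zero_mem _⟩
          symm := fun h => ⟨h.1.symm, by rw [← neg_sub]; exact neg_mem h.2⟩
          trans := fun h h' => ⟨h.1.trans h'.1, by
            rw [← sub_add_sub_cancel]; exact add_mem h.2 h'.2⟩ }
      mul' := by
        rintro u v u' v' ⟨h1, h2⟩ ⟨h3, h4⟩
        refine ⟨by rw [map_mul, map_mul, h1, h3], ?_⟩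
        rw [fox_mul, fox_mul, h1, add_sub_add_comm, ← smul_sub]
        refine add_mem h2 ?_
        rw [← sub_add_cancel (MonoidAlgebra.of ℤ _ (quot X v) • _)
          (fox (quot X) u' - fox (quot X) v')]
        refine add_mem (Submodule.mem_sup_left (Submodule.subset_span ?_)) h4
        exact ⟨_, _, foxBoundary_fox_sub _ h3, rfl⟩ }
  have hle : conGen (FreeRegularStarRel X) ≤ c := by
    refine Con.conGen_le.2 ?_
    rintro _ w ⟨_, rfl, rfl⟩
    rw [mul_assoc]
    refine (Con.eq _).1 (hom_relation_of_tight c.mk' (fun w hw => ?_) _ w.toList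
      (Nat.lt_succ_self _))
    exact (Con.eq _).2 ⟨quot_relation w,
      Submodule.mem_sup_right (Submodule.subset_span ⟨w, hw, rfl⟩)⟩
  refine Submodule.span_le.2 ?_ (mem_span_fox_sub PresentedMonoid.surjective_mk hk)
  rintro _ ⟨u, v, h, rfl⟩
  exact (hle ((Con.eq _).1 h)).2

end Relations

/-! ### Counting letters -/

/-- The numbers of occurrences of the letters in a word, encoded as the image of its Fox
derivative. -/
noncomputable def letterCount (w : List (X ⊕ X)) : (X ⊕ X) →₀ ℤ :=
  chainAugmentation _ _ (fox (quot X) (.ofList w))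

theorem letterCount_append (u v : List (X ⊕ X)) :
    letterCount (u ++ v) = letterCount u + letterCount v :=
  chainAugmentation_fox_mul _ _

theorem letterCount_singleton (a : X ⊕ X) : letterCount [a] = Finsupp.single a 1 := by
  rw [letterCount, FreeMonoid.ofList_singleton, fox_of, chainAugmentation_single, map_one]

theorem letterCount_nil : letterCount ([] : List (X ⊕ X)) = 0 := by
  rw [letterCount, FreeMonoid.ofList_nil, fox_one, map_zero]

theorem chainAugmentation_relCycle (w : List (X ⊕ X)) :
    chainAugmentation _ _ (relCycle w) = letterCount w + letterCount (bar w) := by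
  rw [relCycle, map_sub]
  change letterCount _ - letterCount _ = _
  rw [letterCount_append, letterCount_append]
  abel

theorem chainAugmentation_relCycle_bar (w : List (X ⊕ X)) :
    chainAugmentation _ _ (relCycle (bar w)) = chainAugmentation _ _ (relCycle w) := by
  rw [chainAugmentation_relCycle, chainAugmentation_relCycle, bar_bar, add_comm]

/-- The combination of the relations `x x^⋆ x = x`, for `x ∈ X`, in which the coefficient of each is
that of the unstarred letter `x`; the coefficients of starred letters are ignored. -/
noncomputable def letterCycle (X : Type) : ((X ⊕ X) →₀ ℤ) →ₗ[ℤ] Chains X :=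
  Finsupp.linearCombination ℤ (Sum.elim (fun x => relCycle [Sum.inl x]) 0)

theorem foxBoundary_letterCycle (c : (X ⊕ X) →₀ ℤ) :
    foxBoundary (quot X) (letterCycle X c) = 0 := by
  induction c using Finsupp.induction_linear with
  | zero => simp
  | add c d hc hd => rw [map_add, map_add, hc, hd, add_zero]
  | single a n =>
    rw [letterCycle, Finsupp.linearCombination_single, map_zsmul]
    cases a
    · rw [Sum.elim_inl, foxBoundary_relCycle, smul_zero]
    · rw [Sum.elim_inr, Pi.zero_apply, map_zero, smul_zero]

/-- The class of `w w^⋆ w = w` in the abelianisation depends only on the numbers of letters, and is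
a combination of the classes of the relations `x x^⋆ x = x`. -/
theorem chainAugmentation_letterCycle (w : List (X ⊕ X)) :
    chainAugmentation _ _ (letterCycle X (chainAugmentation _ _ (relCycle w))) =
      chainAugmentation _ _ (relCycle w) := by
  rw [chainAugmentation_relCycle]
  induction w with
  | nil => simp [letterCount_nil]
  | cons a w ih =>
    have h : letterCount (a :: w) + letterCount (bar (a :: w)) =
        (Finsupp.single a 1 + Finsupp.single a.swap 1) + (letterCount w + letterCount (bar w)) := by
      rw [← List.singleton_append, bar_append, letterCount_append, letterCount_append,
        letterCount_singleton, show bar [a] = [a.swap] from rfl, letterCount_singleton]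
      abel
    have ha : chainAugmentation _ _ (letterCycle X (Finsupp.single a 1 + Finsupp.single a.swap 1)) =
        Finsupp.single a 1 + Finsupp.single a.swap 1 := by
      cases a <;>
      simp [letterCycle, chainAugmentation_relCycle, letterCount_singleton, bar, add_comm]
    rw [h, map_add, map_add, ih, ha]

/-! ### Pairs of tight words as a basis -/

/-- The set of pairs `{w, w^⋆}`, where `w` is a tight word of length at least `2`. -/
def TightPair (X : Type) : Type :=
  {q : Sym2 (List (X ⊕ X)) // ∃ w, (Tight w ∧ 2 ≤ w.length) ∧ q = s(w, bar w)}

/-- The pair of a tight word of length at least two. -/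
def TightPair.mk (w : List (X ⊕ X)) (hw : Tight w ∧ 2 ≤ w.length) : TightPair X :=
  ⟨s(w, bar w), w, hw, rfl⟩

open Classical in
/-- The weight that records which relations `w w^⋆ w = w` are used, for `w` tight of length at least
`2`, up to `w ↔ w^⋆`. -/
noncomputable def pairWeight (w : List (X ⊕ X)) : TightPair X →₀ ℤ :=
  if h : Tight w ∧ 2 ≤ w.length then Finsupp.single (TightPair.mk w h) 1 else 0

theorem tight_bar_iff {w : List (X ⊕ X)} : Tight (bar w) ↔ Tight w :=
  ⟨fun h => by simpa using tight_bar h, tight_bar⟩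

theorem pairWeight_bar (w : List (X ⊕ X)) : pairWeight (bar w) = pairWeight w := by
  unfold pairWeight
  by_cases h : Tight w ∧ 2 ≤ w.length
  · have h' : Tight (bar w) ∧ 2 ≤ (bar w).length := by rwa [tight_bar_iff, length_bar]
    rw [dif_pos h, dif_pos h']
    congr 1
    refine Subtype.ext ?_
    change s(bar w, bar (bar w)) = s(w, bar w)
    rw [bar_bar, Sym2.eq_swap]
  · have h' : ¬ (Tight (bar w) ∧ 2 ≤ (bar w).length) := by rwa [tight_bar_iff, length_bar]
    rw [dif_neg h, dif_neg h']

/-- A representative of a pair. -/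
noncomputable def TightPair.word (q : TightPair X) : List (X ⊕ X) := q.2.choose

theorem TightPair.word_spec (q : TightPair X) : Tight q.word ∧ 2 ≤ q.word.length :=
  q.2.choose_spec.1

theorem TightPair.mk_word (q : TightPair X) : TightPair.mk q.word q.word_spec = q :=
  Subtype.ext q.2.choose_spec.2.symm

theorem TightPair.word_mk (w : List (X ⊕ X)) (hw : Tight w ∧ 2 ≤ w.length) :
    (TightPair.mk w hw).word = w ∨ (TightPair.mk w hw).word = bar w := by
  have h : s(w, bar w) = s((TightPair.mk w hw).word, bar (TightPair.mk w hw).word) :=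
    (TightPair.mk w hw).2.choose_spec.2
  have : (TightPair.mk w hw).word ∈ s(w, bar w) := h ▸ Sym2.mem_mk_left _ _
  exact Sym2.mem_iff.1 this

/-- The cycle of a tight relation, corrected by relations `x x^⋆ x = x` so that its class in the
abelianisation vanishes. -/
noncomputable def pairCycle (X : Type) : (TightPair X →₀ ℤ) →ₗ[ℤ] Chains X :=
  Finsupp.linearCombination ℤ fun q =>
    relCycle q.word - letterCycle X (chainAugmentation _ _ (relCycle q.word))

/-- The potential of `pairWeight`, integrated to an additive map on chains: it is invariant on
1-cycles and reads off the weights of the tight relations. -/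
theorem exists_weight_map (X : Type) : ∃ Ψ : Chains X →ₗ[ℤ] (TightPair X →₀ ℤ),
    (∀ (m : FreeRegularStarMonoid X) k, foxBoundary (quot X) k = 0 →
      Ψ (MonoidAlgebra.of ℤ _ m • k) = Ψ k) ∧
    ∀ w, Tight w → Ψ (relCycle w) = pairWeight w := by
  obtain ⟨Ψ, hΨ⟩ := exists_chain_map (π := quot X) PresentedMonoid.surjective_mk
    (potential (pairWeight (X := X))) (fun u v y h => potential_mul_right pairWeight_bar h y)
  refine ⟨Ψ, fun m k hk => ?_, fun w hw => ?_⟩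
  · obtain ⟨x, rfl⟩ := PresentedMonoid.surjective_mk m
    have hk' := mem_span_fox_sub PresentedMonoid.surjective_mk hk
    clear hk
    induction hk' using Submodule.span_induction with
    | mem k hk =>
      obtain ⟨u, v, h, rfl⟩ := hk
      have h1 : MonoidAlgebra.of ℤ _ (quot X x) • (fox (quot X) u - fox (quot X) v) =
          fox (quot X) (x * u) - fox (quot X) (x * v) := by
        rw [fox_mul, fox_mul, add_sub_add_left_eq_sub, smul_sub]
      rw [h1, hΨ _ _ (by rw [map_mul, map_mul, h]), hΨ _ _ h]
      exact potential_mul_left pairWeight_bar h x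
    | zero => rw [smul_zero]
    | add k l _ _ hk hl => rw [smul_add, map_add, map_add, hk, hl]
    | smul n k _ hk => rw [smul_comm, LinearMap.map_smul Ψ n, LinearMap.map_smul Ψ n, hk]
  · exact (hΨ _ _ (quot_relation w)).trans (hw.potential_sub pairWeight_bar)

theorem tight_singleton (a : X ⊕ X) : Tight [a] where
  ne_nil := by simp
  irred v hv h := by
    have := h.length_le
    have := List.length_pos_of_ne_nil hv
    simp at *
    omega
  not_prefix s hs h := by
    have := h.length_le
    have := List.length_pos_of_ne_nil hs
    simp at *
    omega
  not_suffix s hs h := by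
    have := h.length_le
    have := List.length_pos_of_ne_nil hs
    simp at *
    omega

theorem pairWeight_singleton (a : X ⊕ X) : pairWeight [a] = 0 := dif_neg (by simp)

/-- The second homology of the free regular `⋆`-monoid on `X` is free abelian on the pairs
`{w, w^⋆}` of tight words of length at least `2`. -/
theorem nonempty_integralHomology_two_equiv_tightPair (X : Type) :
    Nonempty (integralHomology 2 (FreeRegularStarMonoid X) ≃ₗ[ℤ] (TightPair X →₀ ℤ)) := by
  obtain ⟨Ψ, hΨ, hΨ'⟩ := exists_weight_map X
  let α := chainAugmentation (X ⊕ X) (FreeRegularStarMonoid X)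
  have hlet : ∀ c, Ψ (letterCycle X c) = 0 := fun c => by
    induction c using Finsupp.induction_linear with
    | zero => simp
    | add c d hc hd => rw [map_add, map_add, hc, hd, add_zero]
    | single a n =>
      rw [letterCycle, Finsupp.linearCombination_single, map_smul]
      cases a
      · rw [Sum.elim_inl, hΨ' _ (tight_singleton _), pairWeight_singleton, smul_zero]
      · rw [Sum.elim_inr, Pi.zero_apply, map_zero, smul_zero]
  have hker : ∀ k ∈ cycleCoinvariantsKer X, Ψ k = 0 ∧ α k = 0 := fun k hk => by
    induction hk using Submodule.span_induction with
    | mem k hk =>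
      obtain ⟨m, k, hk, rfl⟩ := hk
      rw [map_sub, map_sub, hΨ m k hk, chainAugmentation_smul, sub_self, sub_self]
      exact ⟨rfl, rfl⟩
    | zero => exact ⟨map_zero _, map_zero _⟩
    | add k l _ _ hk hl =>
      rw [map_add, map_add, hk.1, hk.2, hl.1, hl.2, add_zero, add_zero]
      exact ⟨rfl, rfl⟩
    | smul n k _ hk =>
      rw [map_smul, map_smul, hk.1, hk.2, smul_zero, smul_zero]
      exact ⟨rfl, rfl⟩
  -- up to coinvariants, a cycle is determined by its weight and its class in the abelianisation
  let E : Chains X →ₗ[ℤ] Chains X :=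
    LinearMap.id - (pairCycle X).comp Ψ - (letterCycle X).comp α
  have hE : ∀ k, E k = k - pairCycle X (Ψ k) - letterCycle X (α k) := fun k => rfl
  have hrel : ∀ w, Tight w → E (relCycle w) ∈ cycleCoinvariantsKer X := fun w hw => by
    rw [hE, hΨ' w hw]
    by_cases h2 : 2 ≤ w.length
    · rw [pairWeight, dif_pos ⟨hw, h2⟩, pairCycle, Finsupp.linearCombination_single, one_smul]
      rcases TightPair.word_mk w ⟨hw, h2⟩ with h | h
      · rw [h]
        simp [α]
      · rw [h, chainAugmentation_relCycle_bar]
        have := neg_mem (relCycle_bar_sub_mem w)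
        convert this using 1
        simp only [α]
        abel
    · obtain ⟨a, rfl⟩ : ∃ a, w = [a] := by
        rw [← List.length_eq_one_iff]
        have := List.length_pos_of_ne_nil hw.ne_nil
        omega
      rw [pairWeight_singleton, map_zero, sub_zero]
      simp only [α]
      rw [chainAugmentation_relCycle, show bar [a] = [a.swap] from rfl, letterCount_singleton,
        letterCount_singleton, map_add, letterCycle, Finsupp.linearCombination_single,
        Finsupp.linearCombination_single, one_smul, one_smul]
      cases a with
      | inl x => simp
      | inr x =>
        have := relCycle_bar_sub_mem [Sum.inl x]
        simpa [bar] using this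
  have hcycle : ∀ k, foxBoundary (quot X) k = 0 → E k ∈ cycleCoinvariantsKer X := fun k hk => by
    obtain ⟨y, hy, z, hz, rfl⟩ := Submodule.mem_sup.1 (mem_sup_span_relCycle hk)
    rw [map_add]
    refine add_mem ?_ ?_
    · rw [hE, (hker y hy).1, (hker y hy).2, map_zero, map_zero, sub_zero, sub_zero]
      exact hy
    · clear hk
      induction hz using Submodule.span_induction with
      | mem z hz =>
        obtain ⟨w, hw, rfl⟩ := hz
        exact hrel w hw
      | zero => rw [map_zero]; exact zero_mem _
      | add z z' _ _ hz hz' => rw [map_add]; exact add_mem hz hz'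
      | smul n z _ hz => rw [map_smul]; exact Submodule.smul_mem _ n hz
  refine nonempty_integralHomology_two_equiv_of_fox (π := quot X) PresentedMonoid.surjective_mk Ψ hΨ
    (fun b => ⟨pairCycle X b, ?_⟩) (fun k hk hk' h => ?_)
  · induction b using Finsupp.induction_linear with
    | zero => simp
    | add b c hb hc =>
      rw [map_add, map_add, map_add, map_add, hb.1, hb.2.1, hb.2.2, hc.1, hc.2.1, hc.2.2]
      simp
    | single q n =>
      rw [pairCycle, Finsupp.linearCombination_single, map_zsmul, map_zsmul, map_smul, map_sub,
        map_sub, map_sub, foxBoundary_relCycle, foxBoundary_letterCycle,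
        chainAugmentation_letterCycle, hlet, hΨ' _ q.word_spec.1, pairWeight, dif_pos q.word_spec,
        TightPair.mk_word]
      simp
  · have := hcycle k hk
    rw [hE, h, show α k = 0 from hk', map_zero, map_zero, sub_zero, sub_zero] at this
    exact this

/-! ### Infinitely many tight words -/

theorem tight_replicate (x : X) (n : ℕ) : Tight (List.replicate (n + 1) (Sum.inl x : X ⊕ X)) := by
  -- a power of a generator contains no starred letter, but `s s^⋆` does
  have key : ∀ s : List (X ⊕ X), s ≠ [] →
      ¬ s ++ bar s <:+: List.replicate (n + 1) (Sum.inl x : X ⊕ X) := by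
    intro s hs h
    obtain ⟨a, s, rfl⟩ := List.exists_cons_of_ne_nil hs
    have h1 := List.eq_of_mem_replicate (h.subset (a := a) (by simp))
    have h2 := List.eq_of_mem_replicate (h.subset (a := a.swap) (by simp [bar]))
    rw [h1] at h2
    simp at h2
  exact ⟨by simp, fun v hv h => key v hv (.trans ⟨[], v, by simp⟩ h),
    fun s hs h => key s hs h.isInfix, fun s hs h => key s hs h.isInfix⟩

instance [Nonempty X] : Infinite (TightPair X) := by
  obtain ⟨x⟩ := ‹Nonempty X›
  refine Infinite.of_injective
    (fun n : ℕ => TightPair.mk _ ⟨tight_replicate x (n + 1), by simp⟩) fun m n h => ?_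
  have h1 : s(List.replicate (m + 1 + 1) (Sum.inl x : X ⊕ X), bar _) =
      s(List.replicate (n + 1 + 1) (Sum.inl x), bar _) := congrArg Subtype.val h
  have h2 := Sym2.mem_iff.1 (h1 ▸ Sym2.mem_mk_left _ _)
  rcases h2 with h2 | h2
  all_goals
    have := congrArg List.length h2
    simp at this
    exact this

instance [Countable X] : Countable (TightPair X) := by
  have : Countable (Sym2 (List (X ⊕ X))) := inferInstanceAs (Countable (Quot _))
  exact inferInstanceAs (Countable (Subtype _))

/-- For every nonempty countable set `X`, the second homology of the free regular `⋆`-monoid on `X`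
is free abelian of countably infinite rank. -/
theorem nonempty_integralHomology_two_equiv_nat (X : Type) [Nonempty X] [Countable X] :
    Nonempty (integralHomology 2 (FreeRegularStarMonoid X) ≃ₗ[ℤ] (ℕ →₀ ℤ)) := by
  obtain ⟨e⟩ := nonempty_integralHomology_two_equiv_tightPair X
  obtain ⟨i⟩ := nonempty_equiv_of_countable (α := TightPair X) (β := ℕ)
  exact ⟨e.trans (Finsupp.domLCongr i)⟩

theorem not_finite_nat_finsupp : ¬ Module.Finite ℤ (ℕ →₀ ℤ) := fun _ =>
  not_finite_iff_infinite.2 inferInstance (Module.Finite.finite_basis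
    (Finsupp.basisSingleOne (R := ℤ) (ι := ℕ)))

end FreeRegularStar

theorem mainTheorem4 :
    (∀ r : ℕ, 1 ≤ r →
      ¬ MonoidHomology.IsFP 2 (FreeRegularStarMonoid (Fin r)) ∧
      ¬ Module.Finite ℤ (MonoidHomology.integralHomology 2 (FreeRegularStarMonoid (Fin r)))) ∧
    Nonempty
      (MonoidHomology.integralHomology 2 (FreeRegularStarMonoid (Fin 1)) ≃ₗ[ℤ] (ℕ →₀ ℤ)) := by
  refine ⟨fun r hr => ?_, FreeRegularStar.nonempty_integralHomology_two_equiv_nat (Fin 1)⟩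
  have : Nonempty (Fin r) := ⟨⟨0, hr⟩⟩
  have h : ¬ Module.Finite ℤ
      (MonoidHomology.integralHomology 2 (FreeRegularStarMonoid (Fin r))) := fun _ => by
    obtain ⟨e⟩ := FreeRegularStar.nonempty_integralHomology_two_equiv_nat (Fin r)
    exact FreeRegularStar.not_finite_nat_finsupp (Module.Finite.equiv e)
  exact ⟨fun hFP => h (MonoidHomology.finite_integralHomology_of_isFP hFP), h⟩
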